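/- All logarithms are to base 2, $h_b(p)=-p\log p-(1-p)\log(1-p)$ is the binary entropy function, $h_b^{-1}:[0,1]\to[0,1/2]$ is the inverse of its restriction to $[0,1/2]$, $a*b=a(1-b)+(1-a)b$, $|x|^+=\max(x,0)$, and $\oplus$ is addition modulo 2. Let $0\le p_1,p_3,\delta<1/2$. Consider the following memoryless three-user interference channel with feedback. In each channel use, transmitter 1 sends $(X_{11},X_{12})$ with $X_{11}\in\mathbb Z/3$ and $X_{12}\in\{0,1\}$, transmitter 2 sends $X_2\in\{0,1\}$, and transmitter 3 sends $(X_{32},X_{33},X'_{33})\in\{0,1\}^3$. With $N_1,N_3,N_\delta,E$ mutually independent Bernoulli random variables with parameters $p_1,p_3,\delta,1/2$ (drawn afresh, independently, in each channel use), receiver 1 observes $Y_1=X_{11}+E \bmod 3$; receiver 2 observes $(Y_2,Y_2',Y_2'')=(X_2\oplus E\oplus N_\delta,\; X_{12}\oplus N_1,\; X_{32}\oplus N_3)$; and receiver 3 observes $Y_3=(Y_{33},Y_{33}')=(X_{33}\oplus N_\delta,\; X'_{33}\oplus E)$. The feedback, available at the transmitters with one unit of delay, is $Z_1=Y_1$ at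 transmitter 1, $Z_3=Y_3$ at transmitter 3, and there is none at transmitter 2. (This is the case $\epsilon=0$ of the channel in which $Z_1=Y_1+N_\epsilon \bmod 3$ with an independent Bernoulli($\epsilon$) variable $N_\epsilon$.) An $(M_1,M_2,M_3,N)$ feedback-block-code consists of encoding functions $f_{i,n}:\{1,\dots,M_i\}\times\mathcal Z_i^{n-1}\to\mathcal X_i$, $1\le n\le N$, and decoding functions $g_i:\mathcal Y_i^N\to\{1,\dots,M_i\}$, $i=1,2,3$, where $\mathcal X_i,\mathcal Y_i,\mathcal Z_i$ are the input, output and feedback alphabets of user $i$. The messages $W_i$ are independent and uniform on $\{1,\dots,M_i\}$, the input of transmitter $i$ at time $n$ is $f_{i,n}(W_i,Z_i^{n-1})$, and $P_e$ is the probability that $(g_1(Y_1^N),g_2(Y_2^N),g_3(Y_3^N))\ne(W_1,W_2,W_3)$, where $Y_i^N$ is everything that receiver $i$ observes. A rate triple $(R_1,R_2,R_3)$ is achievable if for every $\eta>0$ there is an $(M_1,M_2,M_3,N)$ feedback-block-code with $P_e\le\eta$ and $\frac1N\log M_i\ge R_i-\eta$ for $i=1,2,3$. Then the rate triple $(\log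 3-1,\;1-h_b(d),\;1-h_b(\delta))$ is achievable, where $d=h_b^{-1}\big(|h_b(p_1*\delta)+h_b(p_3)-1|^+\big)$. -/

import Mathlib

/-- A three-user memoryless interference channel with generalized feedback, over finite alphabets:
`Q x y` is the transition probability `Q(y₁,y₂,y₃ | x₁,x₂,x₃)` and `P y z` is the feedback
probability `P(z₁,z₂,z₃ | y₁,y₂,y₃)`. -/
structure ICFB (X₁ X₂ X₃ Y₁ Y₂ Y₃ Z₁ Z₂ Z₃ : Type)
    [Fintype Y₁] [Fintype Y₂] [Fintype Y₃] [Fintype Z₁] [Fintype Z₂] [Fintype Z₃] where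
  Q : X₁ × X₂ × X₃ → Y₁ × Y₂ × Y₃ → ℝ
  Q_nonneg : ∀ x y, 0 ≤ Q x y
  Q_sum : ∀ x, ∑ y, Q x y = 1
  P : Y₁ × Y₂ × Y₃ → Z₁ × Z₂ × Z₃ → ℝ
  P_nonneg : ∀ y z, 0 ≤ P y z
  P_sum : ∀ y, ∑ z, P y z = 1

/-- An `(M₁, M₂, M₃, N)` feedback-block-code. The times `1, …, N` are indexed by `n : Fin N`
(so `n` counts from `0`), and at time `n` encoder `i` has seen exactly the `n` earlier feedback
symbols `Z_i`. -/
structure FeedbackBlockCode (X₁ X₂ X₃ Y₁ Y₂ Y₃ Z₁ Z₂ Z₃ : Type) (M₁ M₂ M₃ N : ℕ) where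
  enc₁ : (n : Fin N) → Fin M₁ → (Fin n → Z₁) → X₁
  enc₂ : (n : Fin N) → Fin M₂ → (Fin n → Z₂) → X₂
  enc₃ : (n : Fin N) → Fin M₃ → (Fin n → Z₃) → X₃
  dec₁ : (Fin N → Y₁) → Fin M₁
  dec₂ : (Fin N → Y₂) → Fin M₂
  dec₃ : (Fin N → Y₃) → Fin M₃

namespace FeedbackBlockCode

variable {X₁ X₂ X₃ Y₁ Y₂ Y₃ Z₁ Z₂ Z₃ : Type} {M₁ M₂ M₃ N : ℕ}

/-- The channel input at time `n`, for the message triple `w` and the feedback sequence `z`. It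
depends on `z` only through the symbols at times earlier than `n`. -/
def input (c : FeedbackBlockCode X₁ X₂ X₃ Y₁ Y₂ Y₃ Z₁ Z₂ Z₃ M₁ M₂ M₃ N)
    (w : Fin M₁ × Fin M₂ × Fin M₃) (z : Fin N → Z₁ × Z₂ × Z₃) (n : Fin N) : X₁ × X₂ × X₃ :=
  (c.enc₁ n w.1 (fun k => (z (Fin.castLE n.isLt.le k)).1),
   c.enc₂ n w.2.1 (fun k => (z (Fin.castLE n.isLt.le k)).2.1),
   c.enc₃ n w.2.2 (fun k => (z (Fin.castLE n.isLt.le k)).2.2))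

/-- The decoded message triple. -/
def decode (c : FeedbackBlockCode X₁ X₂ X₃ Y₁ Y₂ Y₃ Z₁ Z₂ Z₃ M₁ M₂ M₃ N)
    (y : Fin N → Y₁ × Y₂ × Y₃) : Fin M₁ × Fin M₂ × Fin M₃ :=
  (c.dec₁ (fun n => (y n).1), c.dec₂ (fun n => (y n).2.1), c.dec₃ (fun n => (y n).2.2))

variable [Fintype Y₁] [Fintype Y₂] [Fintype Y₃] [Fintype Z₁] [Fintype Z₂] [Fintype Z₃]

/-- The probability that the output and feedback sequences are `y` and `z`, given that the message
triple is `w`, when the code is used on the channel `C`. -/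
def law (c : FeedbackBlockCode X₁ X₂ X₃ Y₁ Y₂ Y₃ Z₁ Z₂ Z₃ M₁ M₂ M₃ N)
    (C : ICFB X₁ X₂ X₃ Y₁ Y₂ Y₃ Z₁ Z₂ Z₃) (w : Fin M₁ × Fin M₂ × Fin M₃)
    (y : Fin N → Y₁ × Y₂ × Y₃) (z : Fin N → Z₁ × Z₂ × Z₃) : ℝ :=
  ∏ n, C.Q (c.input w z n) (y n) * C.P (y n) (z n)

/-- The probability `P((W₁,W₂,W₃) ≠ (Ŵ₁,Ŵ₂,Ŵ₃))` for independent uniformly distributed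
messages. -/
noncomputable def errorProb (c : FeedbackBlockCode X₁ X₂ X₃ Y₁ Y₂ Y₃ Z₁ Z₂ Z₃ M₁ M₂ M₃ N)
    (C : ICFB X₁ X₂ X₃ Y₁ Y₂ Y₃ Z₁ Z₂ Z₃) : ℝ :=
  ((M₁ : ℝ) * M₂ * M₃)⁻¹ *
    ∑ w : Fin M₁ × Fin M₂ × Fin M₃, ∑ y : Fin N → Y₁ × Y₂ × Y₃, ∑ z : Fin N → Z₁ × Z₂ × Z₃,
      if c.decode y = w then 0 else c.law C w y z

end FeedbackBlockCode

namespace ICFB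

variable {X₁ X₂ X₃ Y₁ Y₂ Y₃ Z₁ Z₂ Z₃ : Type}
  [Fintype Y₁] [Fintype Y₂] [Fintype Y₃] [Fintype Z₁] [Fintype Z₂] [Fintype Z₃]

/-- `η`-achievability of the rate triple `(R₁, R₂, R₃)`; rates are in bits per channel use. -/
def EpsAchievable (C : ICFB X₁ X₂ X₃ Y₁ Y₂ Y₃ Z₁ Z₂ Z₃) (η R₁ R₂ R₃ : ℝ) : Prop :=
  ∃ M₁ M₂ M₃ N : ℕ, 0 < M₁ ∧ 0 < M₂ ∧ 0 < M₃ ∧ 0 < N ∧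
    ∃ c : FeedbackBlockCode X₁ X₂ X₃ Y₁ Y₂ Y₃ Z₁ Z₂ Z₃ M₁ M₂ M₃ N,
      c.errorProb C ≤ η ∧
      R₁ - η ≤ 1 / (N : ℝ) * Real.logb 2 M₁ ∧
      R₂ - η ≤ 1 / (N : ℝ) * Real.logb 2 M₂ ∧
      R₃ - η ≤ 1 / (N : ℝ) * Real.logb 2 M₃

/-- Achievability of the rate triple `(R₁, R₂, R₃)`. -/
def Achievable (C : ICFB X₁ X₂ X₃ Y₁ Y₂ Y₃ Z₁ Z₂ Z₃) (R₁ R₂ R₃ : ℝ) : Prop :=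
  ∀ η : ℝ, 0 < η → C.EpsAchievable η R₁ R₂ R₃

end ICFB

/-- The binary entropy function, in bits. -/
noncomputable def hb (p : ℝ) : ℝ := Real.binEntropy p / Real.log 2

/-- The inverse of the binary entropy function restricted to `[0, 1/2]`. -/
noncomputable def hbInv : ℝ → ℝ := Function.invFunOn hb (Set.Icc 0 (1 / 2))

/-- Binary convolution `p * q = p (1 - q) + (1 - p) q`. -/
def binConv (p q : ℝ) : ℝ := p * (1 - q) + (1 - p) * q

/-- The Bernoulli distribution with parameter `p`. -/
def bern (p : ℝ) (b : Bool) : ℝ := if b then p else 1 - p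

namespace SecondExample

/-- The residue modulo 3 of a bit. -/
def toTernary (b : Bool) : ZMod 3 := if b then 1 else 0

/-- The channel outputs `Y₁`, `(Y₂, Y₂', Y₂'')`, `(Y₃₃, Y₃₃')` as a function of the inputs
`(X₁₁, X₁₂)`, `X₂`, `(X₃₂, X₃₃, X₃₃')` and of the noise bits `(N₁, N₃, N_δ, E)`:
`Y₁ = X₁₁ + E` modulo 3, `Y₂ = X₂ ⊕ E ⊕ N_δ`, `Y₂' = X₁₂ ⊕ N₁`, `Y₂'' = X₃₂ ⊕ N₃`,
`Y₃₃ = X₃₃ ⊕ N_δ`, `Y₃₃' = X₃₃' ⊕ E`. -/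
def output : (ZMod 3 × Bool) × Bool × (Bool × Bool × Bool) → Bool × Bool × Bool × Bool →
    ZMod 3 × (Bool × Bool × Bool) × (Bool × Bool)
  | ((x₁₁, x₁₂), x₂, (x₃₂, x₃₃, x₃₃')), (n₁, n₃, nδ, e) =>
    (x₁₁ + toTernary e,
     (xor x₂ (xor e nδ), xor x₁₂ n₁, xor x₃₂ n₃),
     (xor x₃₃ nδ, xor x₃₃' e))

/-- The law of the independent noise bits `(N₁, N₃, N_δ, E)`. -/
noncomputable def noiseLaw (p₁ p₃ δ : ℝ) : Bool × Bool × Bool × Bool → ℝ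
  | (n₁, n₃, nδ, e) => bern p₁ n₁ * bern p₃ n₃ * bern δ nδ * bern (1 / 2) e

/-- The feedback `Z₁ = Y₁ + N_ε` modulo 3, `Z₂` trivial, `Z₃ = (Y₃₃, Y₃₃')`. -/
def feedback (y : ZMod 3 × (Bool × Bool × Bool) × (Bool × Bool)) (nε : Bool) :
    ZMod 3 × Unit × (Bool × Bool) :=
  (y.1 + toTernary nε, (), y.2.2)

theorem bern_nonneg (p : unitInterval) (b : Bool) : 0 ≤ bern p b := by
  have h0 := p.2.1
  have h1 := p.2.2
  unfold bern
  split_ifs <;> linarith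

/-- The interference channel with feedback, with noise parameters `p₁, p₃, δ, ε`. -/
noncomputable def channel (p₁ p₃ δ ε : unitInterval) :
    ICFB (ZMod 3 × Bool) Bool (Bool × Bool × Bool)
      (ZMod 3) (Bool × Bool × Bool) (Bool × Bool)
      (ZMod 3) Unit (Bool × Bool) where
  Q x y := ∑ v, if output x v = y then noiseLaw p₁ p₃ δ v else 0
  Q_nonneg x y := by
    refine Finset.sum_nonneg fun v _ => ?_
    split_ifs
    · obtain ⟨n₁, n₃, nδ, e⟩ := v
      have h : 0 ≤ bern (1 / 2) e := by unfold bern; split_ifs <;> norm_num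
      exact mul_nonneg (mul_nonneg (mul_nonneg (bern_nonneg _ _) (bern_nonneg _ _))
        (bern_nonneg _ _)) h
    · exact le_rfl
  Q_sum x := by
    rw [Finset.sum_comm]
    simp only [Finset.sum_ite_eq, Finset.mem_univ, if_true]
    simp only [Fintype.sum_prod_type, Fintype.sum_bool, noiseLaw, bern]
    simp
    ring
  P y z := ∑ n, if feedback y n = z then bern ε n else 0
  P_nonneg y z := by
    refine Finset.sum_nonneg fun v _ => ?_
    split_ifs
    · exact bern_nonneg _ _
    · exact le_rfl
  P_sum y := by
    rw [Finset.sum_comm]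
    simp [bern]

end SecondExample

/-! The proof is block Markov coding: `B` submessages per user are sent in the first `B` of `B + 1`
blocks, and each block also carries side information about the noise of the preceding one. Users 1
and 3 face point-to-point problems. The noise of receiver 1 takes 2^n of 3^n values, which allows
every rate below log 3 - 1; receiver 3 has a binary symmetric channel with crossover probability δ.

Receiver 2 sees its codeword under S = E ⊕ N_δ. Feedback reveals E to transmitter 1 and S to
transmitter 3. One block later transmitter 1 sends E uncoded; adding its noisy copy to Y₂ leaves the
codeword plus N_δ ⊕ N₁. Transmitter 3 sends F(S) for a random function F. A wrong message with a
different codeword implies a wrong candidate for S, at which F is independent of F(S), so it passes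
the two tests with probabilities about 2^(-n(1 - h_b(p₁*δ))) and 2^(-n(1 - h_b(p₃))), which
multiply. Equal codewords have probability 2^(-n). Hence every rate below min(1, 2 - h_b(p₁*δ) -
h_b(p₃)) = 1 - h_b(d) works.

`errorProb_le` turns the error probability into a sum over noise sequences, `exists_of_decode_ne`
lists the error events, `sum_ite_ambiguous_le` and `sum_ite_ambiguous_describe_le` average over
codes, `card_lowWeight_le` and `sum_ite_not_mem_lowWeight_le` handle typicality, and `exists_code`
combines them. -/

namespace SecondExample

/-! ### The channel as a deterministic system driven by noise -/

/-- The noise bits `(N₁, N₃, N_δ, E)` of one channel use. -/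
abbrev Noise := Bool × Bool × Bool × Bool

abbrev ChannelCode (M₁ M₂ M₃ N : ℕ) :=
  FeedbackBlockCode (ZMod 3 × Bool) Bool (Bool × Bool × Bool)
    (ZMod 3) (Bool × Bool × Bool) (Bool × Bool) (ZMod 3) Unit (Bool × Bool) M₁ M₂ M₃ N

/-- The output and feedback sequences `y` and `z` arise from the messages `w` and the noise `v`
when the feedback is noiseless. -/
def Consistent {M₁ M₂ M₃ N : ℕ} (c : ChannelCode M₁ M₂ M₃ N) (w : Fin M₁ × Fin M₂ × Fin M₃)
    (v : Fin N → Noise) (y : Fin N → ZMod 3 × (Bool × Bool × Bool) × (Bool × Bool))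
    (z : Fin N → ZMod 3 × Unit × (Bool × Bool)) : Prop :=
  ∀ n, output (c.input w z n) (v n) = y n ∧ feedback (y n) false = z n

/-- Causality: each input depends only on earlier feedback, so strong induction on time recovers the
whole trajectory from messages and noise. -/
theorem Consistent.unique {M₁ M₂ M₃ N : ℕ} {c : ChannelCode M₁ M₂ M₃ N}
    {w : Fin M₁ × Fin M₂ × Fin M₃} {v : Fin N → Noise}
    {y y' : Fin N → ZMod 3 × (Bool × Bool × Bool) × (Bool × Bool)}
    {z z' : Fin N → ZMod 3 × Unit × (Bool × Bool)}
    (h : Consistent c w v y z) (h' : Consistent c w v y' z') : y = y' ∧ z = z' := by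
  have key : ∀ k : ℕ, ∀ n : Fin N, (n : ℕ) = k → y n = y' n ∧ z n = z' n := by
    intro k
    induction k using Nat.strong_induction_on with
    | _ k ih =>
      intro n hn
      have hz : ∀ j : Fin n, z (Fin.castLE n.isLt.le j) = z' (Fin.castLE n.isLt.le j) := fun j =>
        (ih j (by have := j.isLt; omega) _ rfl).2
      have hi : c.input w z n = c.input w z' n := by
        simp only [FeedbackBlockCode.input, hz]
      have hy : y n = y' n := by rw [← (h n).1, ← (h' n).1, hi]
      exact ⟨hy, by rw [← (h n).2, ← (h' n).2, hy]⟩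
  exact ⟨funext fun n => (key _ n rfl).1, funext fun n => (key _ n rfl).2⟩

theorem noiseLaw_nonneg (p₁ p₃ δ : unitInterval) (v : Noise) : 0 ≤ noiseLaw p₁ p₃ δ v := by
  obtain ⟨n₁, n₃, nδ, e⟩ := v
  have h : 0 ≤ bern (1 / 2) e := by unfold bern; split_ifs <;> norm_num
  exact mul_nonneg (mul_nonneg (mul_nonneg (bern_nonneg _ _) (bern_nonneg _ _))
    (bern_nonneg _ _)) h

theorem sum_noiseLaw (p₁ p₃ δ : ℝ) : ∑ v, noiseLaw p₁ p₃ δ v = 1 := by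
  simp only [Fintype.sum_prod_type, Fintype.sum_bool, noiseLaw, bern]
  simp
  ring

open Classical in
theorem law_eq_sum {M₁ M₂ M₃ N : ℕ} (c : ChannelCode M₁ M₂ M₃ N) (p₁ p₃ δ : unitInterval)
    (w : Fin M₁ × Fin M₂ × Fin M₃) (y : Fin N → ZMod 3 × (Bool × Bool × Bool) × (Bool × Bool))
    (z : Fin N → ZMod 3 × Unit × (Bool × Bool)) :
    c.law (channel p₁ p₃ δ 0) w y z =
      ∑ v : Fin N → Noise, if Consistent c w v y z then ∏ n, noiseLaw p₁ p₃ δ (v n) else 0 := by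
  have hP : ∀ n, (channel p₁ p₃ δ 0).P (y n) (z n) =
      if feedback (y n) false = z n then 1 else 0 := by
    intro n
    simp [channel, bern]
  have hf : ∀ n, (channel p₁ p₃ δ 0).Q (c.input w z n) (y n) * (channel p₁ p₃ δ 0).P (y n) (z n) =
      ∑ v : Noise, if output (c.input w z n) v = y n ∧ feedback (y n) false = z n then
        noiseLaw p₁ p₃ δ v else 0 := by
    intro n
    rw [hP]
    by_cases hz : feedback (y n) false = z n
    · simp [hz, channel]
    · simp [hz]
  simp only [FeedbackBlockCode.law, hf]
  -- A product over time of sums over one noise symbol is a sum over noise sequences.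
  rw [Finset.prod_univ_sum, Fintype.piFinset_univ]
  refine Finset.sum_congr rfl fun v _ => ?_
  rw [Finset.prod_ite_zero]
  exact if_congr (by simp [Consistent]) rfl rfl

/-- The error probability is the probability of any event of messages and noise sequences that
contains all decoding errors; here the event is relaxed to a nonnegative weight `φ`. -/
theorem errorProb_le {M₁ M₂ M₃ N : ℕ} (c : ChannelCode M₁ M₂ M₃ N) (p₁ p₃ δ : unitInterval)
    (φ : Fin M₁ × Fin M₂ × Fin M₃ → (Fin N → Noise) → ℝ) (hφ : ∀ w v, 0 ≤ φ w v)
    (h : ∀ w v y z, Consistent c w v y z → c.decode y ≠ w → 1 ≤ φ w v) :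
    c.errorProb (channel p₁ p₃ δ 0) ≤ ((M₁ : ℝ) * M₂ * M₃)⁻¹ *
      ∑ w, ∑ v : Fin N → Noise, (∏ n, noiseLaw p₁ p₃ δ (v n)) * φ w v := by
  classical
  refine mul_le_mul_of_nonneg_left (Finset.sum_le_sum fun w _ => ?_) (by positivity)
  simp only [law_eq_sum]
  have hprod : ∀ v : Fin N → Noise, 0 ≤ ∏ n, noiseLaw p₁ p₃ δ (v n) := fun v =>
    Finset.prod_nonneg fun n _ => noiseLaw_nonneg _ _ _ _
  calc _ = ∑ v : Fin N → Noise, ∑ x : (Fin N → ZMod 3 × (Bool × Bool × Bool) × (Bool × Bool)) ×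
          (Fin N → ZMod 3 × Unit × (Bool × Bool)), (if c.decode x.1 = w then 0 else
            if Consistent c w v x.1 x.2 then ∏ n, noiseLaw p₁ p₃ δ (v n) else 0) := by
        rw [Finset.sum_comm (s := (Finset.univ : Finset (Fin N → Noise))), Fintype.sum_prod_type]
        refine Finset.sum_congr rfl fun y _ => Finset.sum_congr rfl fun z _ => ?_
        split_ifs <;> simp
    _ ≤ _ := by
        refine Finset.sum_le_sum fun v _ => ?_
        by_cases hx : ∃ x : (Fin N → ZMod 3 × (Bool × Bool × Bool) × (Bool × Bool)) ×
          (Fin N → ZMod 3 × Unit × (Bool × Bool)), Consistent c w v x.1 x.2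
        · obtain ⟨x, hx⟩ := hx
          rw [Finset.sum_eq_single x]
          · split_ifs with hd
            · exact mul_nonneg (hprod v) (hφ w v)
            · exact le_mul_of_one_le_right (hprod v) (h w v _ _ hx hd)
          · intro x' _ hne
            have hx' : ¬ Consistent c w v x'.1 x'.2 := fun hx' =>
              hne (Prod.ext (hx'.unique hx).1 (hx'.unique hx).2)
            rw [if_neg hx', ite_self]
          · simp
        · rw [Finset.sum_eq_zero fun x _ => by
            rw [if_neg (c := Consistent c w v x.1 x.2) fun hx' => hx ⟨x, hx'⟩, ite_self]]
          exact mul_nonneg (hprod v) (hφ w v)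

end SecondExample

/-! ### Random coding -/

/-- Derandomization by exchanging sums. Since the average over codes `k` is bounded for each fixed
`ω`, messages and noise can be frozen while the code is averaged. -/
theorem exists_sum_le_of_forall_sum_le {K Ω : Type*} [Fintype K] [Nonempty K] [Fintype Ω]
    (P : Ω → ℝ) (hP : ∀ ω, 0 ≤ P ω) (hP1 : ∑ ω, P ω = 1) (φ : K → Ω → ℝ) (a : ℝ)
    (h : ∀ ω, ∑ k, φ k ω ≤ a * Fintype.card K) : ∃ k, ∑ ω, P ω * φ k ω ≤ a := by
  have : ∑ k, ∑ ω, P ω * φ k ω ≤ ∑ _k : K, a := by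
    rw [Finset.sum_comm]
    calc ∑ ω, ∑ k, P ω * φ k ω = ∑ ω, P ω * ∑ k, φ k ω := by simp only [Finset.mul_sum]
      _ ≤ ∑ ω, P ω * (a * Fintype.card K) :=
        Finset.sum_le_sum fun ω _ => mul_le_mul_of_nonneg_left (h ω) (hP ω)
      _ = ∑ _k : K, a := by rw [← Finset.sum_mul, hP1]; simp [mul_comm]
  obtain ⟨k, -, hk⟩ := Finset.exists_le_of_sum_le Finset.univ_nonempty this
  exact ⟨k, hk⟩

/-- For a uniformly random function `F : ι → H` into a finite group, the difference of two of its
values is uniformly distributed. -/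
theorem sum_ite_sub_mem {ι H : Type*} [Fintype ι] [DecidableEq ι] [AddCommGroup H] [Fintype H]
    [DecidableEq H]
    {a b : ι} (hab : a ≠ b) (k : H) (T : Finset H) :
    ∑ F : ι → H, (if k + F a - F b ∈ T then (1 : ℝ) else 0) =
      T.card / Fintype.card H * Fintype.card (ι → H) := by
  have hH : (Fintype.card H : ℝ) ≠ 0 := by exact_mod_cast Fintype.card_ne_zero
  set S := ∑ F : ι → H, (if k + F a - F b ∈ T then (1 : ℝ) else 0) with hS
  -- Translating the value at `a` by `g` permutes the functions `F`; averaging over `g` then makes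
  -- the tested element uniform.
  have h1 : ∀ g : H, ∑ F : ι → H, (if g + (k + F a - F b) ∈ T then (1 : ℝ) else 0) = S := by
    intro g
    rw [hS, ← Equiv.sum_comp (Equiv.addRight (Pi.single a g : ι → H))
      (fun F => if k + F a - F b ∈ T then (1 : ℝ) else 0)]
    refine Finset.sum_congr rfl fun F _ => ?_
    have : k + (Equiv.addRight (Pi.single a g : ι → H) F) a -
        (Equiv.addRight (Pi.single a g : ι → H) F) b = g + (k + F a - F b) := by
      simp [hab.symm]; abel
    rw [this]
  have h2 : ∀ x : H, ∑ g : H, (if g + x ∈ T then (1 : ℝ) else 0) = T.card := by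
    intro x
    refine (Equiv.sum_comp (Equiv.addRight x) (fun g => if g ∈ T then (1 : ℝ) else 0)).trans ?_
    simp
  have h3 : Fintype.card H * S = T.card * Fintype.card (ι → H) := by
    calc Fintype.card H * S = ∑ g : H, S := by simp
      _ = ∑ g : H, ∑ F : ι → H, (if g + (k + F a - F b) ∈ T then (1 : ℝ) else 0) := by
        simp only [h1]
      _ = _ := by rw [Finset.sum_comm]; simp only [h2]; simp [mul_comm]
  field_simp
  linarith

/-- Random coding: for a random codebook, a noise set `T` and a noise sequence `s`, another
codeword explains the output `c w + s` with probability at most `(m - 1) |T| / |H|`. -/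
theorem sum_ite_ambiguous_le {H : Type*} [AddCommGroup H] [Fintype H] [DecidableEq H]
    {m : ℕ}
    (w : Fin m) (s : H) (T : Finset H) :
    ∑ c : Fin m → H, (if ∃ w', w' ≠ w ∧ c w + s - c w' ∈ T then (1 : ℝ) else 0) ≤
      (m - 1) * (T.card / Fintype.card H) * Fintype.card (Fin m → H) := by
  calc _ ≤ ∑ c : Fin m → H, ∑ w' ∈ Finset.univ.erase w,
        (if s + c w - c w' ∈ T then (1 : ℝ) else 0) := by
        refine Finset.sum_le_sum fun c _ => ?_
        split_ifs with h
        · obtain ⟨w', hw', h⟩ := h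
          refine le_trans ?_ (Finset.single_le_sum (f := fun w' =>
            (if s + c w - c w' ∈ T then (1 : ℝ) else 0))
            (fun i _ => by positivity) (Finset.mem_erase.2 ⟨hw', Finset.mem_univ _⟩))
          rw [add_comm] at h
          simp [h]
        · exact Finset.sum_nonneg fun i _ => by positivity
    _ = ∑ w' ∈ Finset.univ.erase w, T.card / Fintype.card H * (Fintype.card (Fin m → H) : ℝ) := by
        rw [Finset.sum_comm]
        exact Finset.sum_congr rfl fun w' hw' =>
          sum_ite_sub_mem (Finset.ne_of_mem_erase hw').symm s T
    _ = _ := by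
        have : 1 ≤ m := w.pos
        simp [Finset.card_erase_of_mem, Nat.cast_sub this, mul_assoc]

/-- Random coding with a random description `F` of the noise: the probability that another
codeword passes the tests of both noise sets. -/
theorem sum_ite_ambiguous_describe_le {H : Type*} [AddCommGroup H] [Fintype H] [DecidableEq H]
    {m : ℕ}
    (w : Fin m) (s u k : H) (T T' : Finset H) :
    ∑ c : (Fin m → H) × (H → H), (if ∃ w', w' ≠ w ∧ c.1 w + u - c.1 w' ∈ T ∧
        c.2 s + k - c.2 (c.1 w + s - c.1 w') ∈ T' then (1 : ℝ) else 0) ≤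
      (m - 1) * (1 / Fintype.card H + T.card / Fintype.card H * (T'.card / Fintype.card H)) *
        Fintype.card ((Fin m → H) × (H → H)) := by
  have key : ∀ w', w' ≠ w → ∑ c : (Fin m → H) × (H → H), (if c.1 w + u - c.1 w' ∈ T ∧
        c.2 s + k - c.2 (c.1 w + s - c.1 w') ∈ T' then (1 : ℝ) else 0) ≤
      (1 / Fintype.card H + T.card / Fintype.card H * (T'.card / Fintype.card H)) *
        Fintype.card ((Fin m → H) × (H → H)) := by
    intro w' hw'
    rw [Fintype.sum_prod_type]
    calc _ ≤ ∑ c : Fin m → H, ((if 0 + c w - c w' ∈ ({0} : Finset H) then (1 : ℝ) else 0) +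
          (if u + c w - c w' ∈ T then 1 else 0) * (T'.card / Fintype.card H)) *
            Fintype.card (H → H) := by
          refine Finset.sum_le_sum fun c _ => ?_
          -- Colliding codewords imply the same noise, so `F` cannot separate them; they are charged
          -- in full to the event that the difference lies in `{0}`. Otherwise `F` is evaluated at
          -- two distinct points and contributes the factor for `T'`.
          by_cases h0 : c w = c w'
          · calc _ ≤ ∑ F : H → H, (1 : ℝ) := Finset.sum_le_sum fun F _ => by
                  split_ifs <;> norm_num
              _ = 1 * (Fintype.card (H → H) : ℝ) := by simp
              _ ≤ _ := by
                refine mul_le_mul_of_nonneg_right ?_ (by positivity)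
                rw [if_pos (by simp [h0])]
                exact le_add_of_nonneg_right (by positivity)
          · have hne : s ≠ c w + s - c w' := by
              intro h
              apply h0
              have : c w = c w' + (s - s) := by nth_rewrite 1 [h]; abel
              simpa using this
            by_cases h1 : u + c w - c w' ∈ T
            · rw [if_pos h1, if_neg (by simpa [sub_eq_zero] using h0)]
              have h2 := sum_ite_sub_mem hne k T'
              rw [zero_add, one_mul, ← h2]
              refine Finset.sum_le_sum fun F _ => ?_
              rw [add_comm k]
              by_cases h3 : F s + k - F (c w + s - c w') ∈ T'
              · rw [if_pos h3]; split_ifs <;> norm_num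
              · simp [h3]
            · rw [add_comm] at h1
              simp only [h1, false_and, if_false, Finset.sum_const_zero]
              positivity
      _ = _ := by
          rw [← Finset.sum_mul, Finset.sum_add_distrib, ← Finset.sum_mul,
            sum_ite_sub_mem hw'.symm, sum_ite_sub_mem hw'.symm]
          rw [Fintype.card_prod]
          push_cast [Finset.card_singleton]
          ring
  calc _ ≤ ∑ c : (Fin m → H) × (H → H), ∑ w' ∈ Finset.univ.erase w,
        (if c.1 w + u - c.1 w' ∈ T ∧
          c.2 s + k - c.2 (c.1 w + s - c.1 w') ∈ T' then (1 : ℝ) else 0) := by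
        refine Finset.sum_le_sum fun c _ => ?_
        split_ifs with h
        · obtain ⟨w', hw', h⟩ := h
          refine le_trans ?_ (Finset.single_le_sum (f := fun w' =>
            (if c.1 w + u - c.1 w' ∈ T ∧
              c.2 s + k - c.2 (c.1 w + s - c.1 w') ∈ T' then (1 : ℝ) else 0))
            (fun i _ => by positivity) (Finset.mem_erase.2 ⟨hw', Finset.mem_univ _⟩))
          simp only [h, and_self, if_true, le_refl]
        · exact Finset.sum_nonneg fun i _ => by positivity
    _ ≤ ∑ w' ∈ Finset.univ.erase w, (1 / Fintype.card H + T.card / Fintype.card H *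
          (T'.card / Fintype.card H)) * (Fintype.card ((Fin m → H) × (H → H)) : ℝ) := by
        rw [Finset.sum_comm]
        exact Finset.sum_le_sum fun w' hw' => key w' (Finset.ne_of_mem_erase hw')
    _ = _ := by
        have : 1 ≤ m := w.pos
        rw [Finset.sum_const, Finset.card_erase_of_mem (Finset.mem_univ _), nsmul_eq_mul,
          Finset.card_univ, Fintype.card_fin, Nat.cast_sub this]
        push_cast
        ring

/-! ### Second moments, weights and typical noise -/

/-- Independence of the coordinates: those outside `S` contribute total mass 1. The case `S = ∅` is
the normalization of the product law. -/
theorem sum_prod_mul_prod {ι α : Type*} [Fintype ι] [DecidableEq ι] [Fintype α]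
    (p : α → ℝ) (hp : ∑ a, p a = 1) (f : ι → α → ℝ) (S : Finset ι) :
    ∑ v : ι → α, (∏ i, p (v i)) * ∏ i ∈ S, f i (v i) = ∏ i ∈ S, ∑ a, p a * f i a := by
  have h : ∀ v : ι → α, (∏ i, p (v i)) * ∏ i ∈ S, f i (v i) =
      ∏ i, p (v i) * (if i ∈ S then f i (v i) else 1) := by
    intro v
    rw [Finset.prod_mul_distrib, Finset.prod_ite_mem, Finset.univ_inter]
  simp only [h]
  have h2 := Finset.prod_univ_sum (fun _ : ι => (Finset.univ : Finset α))
    (fun i a => p a * (if i ∈ S then f i a else 1))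
  rw [Fintype.piFinset_univ] at h2
  rw [← h2]
  have h3 : ∀ i, ∑ a, p a * (if i ∈ S then f i a else 1) =
      if i ∈ S then ∑ a, p a * f i a else 1 := by
    intro i
    split_ifs <;> simp [hp]
  simp only [h3]
  rw [Finset.prod_ite_mem, Finset.univ_inter]

/-- The second moment of a sum of `±1`-valued variables that are products over disjoint sets of
coordinates. -/
theorem sum_prod_mul_sq_le {ι α κ : Type*} [Fintype ι] [DecidableEq ι] [Fintype α] [Fintype κ]
    (p : α → ℝ) (hp : ∑ a, p a = 1) (f : ι → α → ℝ) (hf : ∀ i a, f i a ^ 2 = 1)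
    (S : κ → Finset ι) (hS : Pairwise fun t t' => Disjoint (S t) (S t')) (μ : ℝ)
    (hμ : ∀ t, ∏ i ∈ S t, ∑ a, p a * f i a = μ) :
    ∑ v : ι → α, (∏ i, p (v i)) * (∑ t, ∏ i ∈ S t, f i (v i) - Fintype.card κ * μ) ^ 2 ≤
      Fintype.card κ := by
  classical
  set P : (ι → α) → ℝ := fun v => ∏ i, p (v i) with hPdef
  set X : κ → (ι → α) → ℝ := fun t v => ∏ i ∈ S t, f i (v i) with hX
  have hP1 : ∑ v, P v = 1 := by
    simpa using sum_prod_mul_prod p hp f ∅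
  have hE : ∀ t, ∑ v, P v * X t v = μ := fun t => by
    rw [← hμ t]; exact sum_prod_mul_prod p hp f (S t)
  -- On the diagonal the square of a sign is 1; off it, disjoint supports make the variables
  -- uncorrelated.
  have hEE : ∀ t t', ∑ v, P v * (X t v * X t' v) = μ ^ 2 + if t = t' then 1 - μ ^ 2 else 0 := by
    intro t t'
    split_ifs with h
    · subst h
      have : ∀ v, X t v * X t v = 1 := fun v => by
        rw [← sq, hX, ← Finset.prod_pow]
        simp only [hf, Finset.prod_const_one]
      simp [this, hP1]
    · have := sum_prod_mul_prod p hp f (S t ∪ S t')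
      rw [Finset.prod_union (hS h), hμ, hμ] at this
      rw [add_zero, sq, ← this]
      refine Finset.sum_congr rfl fun v _ => ?_
      rw [Finset.prod_union (hS h)]
  have hexp : ∀ v, P v * (∑ t, X t v - Fintype.card κ * μ) ^ 2 =
      (∑ t, ∑ t', P v * (X t v * X t' v)) - 2 * Fintype.card κ * μ * (∑ t, P v * X t v) +
        (Fintype.card κ * μ) ^ 2 * P v := by
    intro v
    simp only [← Finset.mul_sum, ← Finset.sum_mul]
    ring
  calc _ = ∑ v, P v * (∑ t, X t v - Fintype.card κ * μ) ^ 2 := rfl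
    _ = (∑ t, ∑ t', ∑ v, P v * (X t v * X t' v)) -
        2 * Fintype.card κ * μ * (∑ t, ∑ v, P v * X t v) + (Fintype.card κ * μ) ^ 2 := by
        simp only [hexp]
        rw [Finset.sum_add_distrib, Finset.sum_sub_distrib, ← Finset.mul_sum, ← Finset.mul_sum,
          hP1, mul_one, Finset.sum_comm]
        congr 2
        · exact Finset.sum_congr rfl fun t _ => Finset.sum_comm
        · rw [Finset.sum_comm]
    _ = Fintype.card κ * (1 - μ ^ 2) := by
        simp only [hE, hEE, Finset.sum_add_distrib, Finset.sum_ite_eq, Finset.mem_univ, if_true,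
          Finset.sum_const, Finset.card_univ, nsmul_eq_mul]
        ring
    _ ≤ _ := by nlinarith [sq_nonneg μ, (Fintype.card κ).cast_nonneg (α := ℝ)]

/-- The number of ones of a binary sequence. -/
def weight {n : ℕ} (s : Fin n → Bool) : ℕ := (Finset.univ.filter fun t => s t = true).card

/-- The binary sequences of relative weight at most `r`. -/
noncomputable def lowWeight (n : ℕ) (r : ℝ) : Finset (Fin n → Bool) :=
  Finset.univ.filter fun s => (weight s : ℝ) ≤ n * r

theorem mem_lowWeight {n : ℕ} {r : ℝ} {s : Fin n → Bool} :
    s ∈ lowWeight n r ↔ (weight s : ℝ) ≤ n * r := by simp [lowWeight]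

theorem two_rpow_hb (n : ℕ) (r : ℝ) : (2 : ℝ) ^ (n * hb r) = Real.exp (n * Real.binEntropy r) := by
  rw [Real.rpow_def_of_pos two_pos, hb]
  have : Real.log 2 ≠ 0 := (Real.log_pos one_lt_two).ne'
  congr 1
  field_simp

/-- Under the Bernoulli(`r`) product law each of these sequences has probability at least 2^(-n
h_b(r)), because for `r < 1/2` fewer ones only make a sequence more likely. The total mass is 1. -/
theorem card_lowWeight_le (n : ℕ) {r : ℝ} (h0 : 0 < r) (h1 : r < 1 / 2) :
    ((lowWeight n r).card : ℝ) ≤ 2 ^ (n * hb r) := by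
  have hr1 : 0 < 1 - r := by linarith
  have hprod : ∀ s : Fin n → Bool, ∏ t, bern r (s t) =
      Real.exp (weight s * Real.log r + (n - weight s) * Real.log (1 - r)) := by
    intro s
    have : ∀ b, bern r b = Real.exp (if b = true then Real.log r else Real.log (1 - r)) := by
      intro b; cases b <;> simp [bern, Real.exp_log, h0, hr1]
    simp only [this, ← Real.exp_sum, Finset.sum_ite, Finset.sum_const, nsmul_eq_mul]
    have hc : (Finset.univ.filter fun t => ¬ s t = true).card = (n : ℝ) - weight s := by
      have := Finset.card_filter_add_card_filter_not (s := (Finset.univ : Finset (Fin n)))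
        (fun t => s t = true)
      rw [Finset.card_univ, Fintype.card_fin] at this
      rw [weight, eq_sub_iff_add_eq, add_comm]
      exact_mod_cast this
    rw [hc]
    rfl
  have hsum : ∑ s : Fin n → Bool, ∏ t, bern r (s t) = 1 := by
    have := sum_prod_mul_prod (ι := Fin n) (bern r) (by simp [bern]) (fun _ _ => 1) ∅
    simpa using this
  have hlow : ∀ s ∈ lowWeight n r, Real.exp (-(n * Real.binEntropy r)) ≤ ∏ t, bern r (s t) := by
    intro s hs
    rw [mem_lowWeight] at hs
    rw [hprod, Real.exp_le_exp, Real.binEntropy_eq_negMulLog_add_negMulLog_one_sub,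
      Real.negMulLog, Real.negMulLog]
    have hlog : Real.log r ≤ Real.log (1 - r) := Real.log_le_log h0 (by linarith)
    nlinarith
  have : ((lowWeight n r).card : ℝ) * Real.exp (-(n * Real.binEntropy r)) ≤ 1 := by
    rw [← hsum, ← nsmul_eq_mul]
    refine (Finset.card_nsmul_le_sum _ _ _ hlow).trans ?_
    refine Finset.sum_le_univ_sum_of_nonneg fun s => ?_
    rw [hprod]; positivity
  rw [two_rpow_hb]
  rw [Real.exp_neg] at this
  have hpos := Real.exp_pos (n * Real.binEntropy r)
  field_simp at this
  exact this

/-- The sign `(-1)^b` of a bit. -/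
def sign (b : Bool) : ℝ := if b then -1 else 1

theorem sum_sign {n : ℕ} (s : Fin n → Bool) : ∑ t, sign (s t) = n - 2 * weight s := by
  have : ∀ b, sign b = 1 - 2 * (if b = true then 1 else 0) := by
    intro b; cases b <;> norm_num [sign]
  simp only [this, Finset.sum_sub_distrib, ← Finset.mul_sum, weight, Finset.sum_boole]
  simp

/-- Chebyshev's inequality for the weight of a binary sequence whose bits are sums of noise bits at
disjoint sets of coordinates. -/
theorem sum_ite_not_mem_lowWeight_le {ι α : Type*} [Fintype ι] [DecidableEq ι] [Fintype α] {n : ℕ}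
    (p : α → ℝ) (hp0 : ∀ a, 0 ≤ p a) (hp : ∑ a, p a = 1) (f : ι → α → ℝ)
    (hf : ∀ i a, f i a ^ 2 = 1) (S : Fin n → Finset ι)
    (hS : Pairwise fun t t' => Disjoint (S t) (S t')) (q r : ℝ) (hqr : q < r)
    (hq : ∀ t, ∏ i ∈ S t, ∑ a, p a * f i a = 1 - 2 * q) (s : (ι → α) → Fin n → Bool)
    (hs : ∀ v t, sign (s v t) = ∏ i ∈ S t, f i (v i)) (hn : 0 < n) :
    ∑ v : ι → α, (∏ i, p (v i)) * (if s v ∉ lowWeight n r then 1 else 0) ≤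
      1 / (4 * (r - q) ^ 2) / n := by
  have hn' : (0 : ℝ) < n := by exact_mod_cast hn
  have hd : 0 < r - q := sub_pos.2 hqr
  have h := sum_prod_mul_sq_le p hp f hf S hS _ hq
  simp only [← hs, sum_sign, Fintype.card_fin] at h
  -- A weight above `n * r` puts the sum of signs more than `2 * n * (r - q)` below its mean `n * (1
  -- - 2 * q)`, while the second moment is at most `n`.
  have hle : (4 * (r - q) ^ 2 * (n : ℝ) ^ 2) *
      ∑ v : ι → α, (∏ i, p (v i)) * (if s v ∉ lowWeight n r then 1 else 0) ≤ n := by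
    refine le_trans ?_ h
    rw [Finset.mul_sum]
    refine Finset.sum_le_sum fun v _ => ?_
    rw [mul_left_comm]
    refine mul_le_mul_of_nonneg_left ?_ (Finset.prod_nonneg fun i _ => hp0 _)
    split_ifs with hv
    · rw [mul_zero]; positivity
    · rw [mem_lowWeight, not_le] at hv
      have : 0 < 2 * (n * (r - q)) := by positivity
      have h2 : 2 * (n * (r - q)) ≤ 2 * weight (s v) - 2 * n * q := by linarith
      nlinarith
  rw [div_div, le_div_iff₀ (by positivity)]
  nlinarith [mul_pos hn' hn']

/-! ### The block Markov code and its error events -/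

namespace SecondExample

/-- The `t`-th channel use of block `b`. -/
def slot {B n : ℕ} (b : Fin B) (t : Fin n) : Fin (B * n) := finProdFinEquiv (b, t)

theorem divNat_slot {B n : ℕ} (b : Fin B) (t : Fin n) : (slot b t).divNat = b :=
  congrArg Prod.fst (finProdFinEquiv.symm_apply_apply (b, t))

theorem modNat_slot {B n : ℕ} (b : Fin B) (t : Fin n) : (slot b t).modNat = t :=
  congrArg Prod.snd (finProdFinEquiv.symm_apply_apply (b, t))

theorem slot_inj {B n : ℕ} {b b' : Fin B} {t t' : Fin n} :
    slot b t = slot b' t' ↔ b = b' ∧ t = t' := by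
  simp [slot]

theorem val_slot {B n : ℕ} (b : Fin B) (t : Fin n) : (slot b t : ℕ) = t + n * b := rfl

/-- This makes the scheme causal: all feedback of a block is available throughout the next one. -/
theorem slot_castSucc_lt {B n : ℕ} (b : Fin B) (t t' : Fin n) :
    slot b.castSucc t < slot b.succ t' := by
  rw [Fin.lt_def, val_slot, val_slot, Fin.val_succ, Fin.val_castSucc, Nat.mul_succ]
  have := t.isLt
  omega

/-- The symbol with index `i` of a sequence of `k` past symbols. -/
def past {Z : Type} (d : Z) {k : ℕ} (z : Fin k → Z) (i : ℕ) : Z := if h : i < k then z ⟨i, h⟩ else d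

theorem past_eq {Z Z' : Type} (d : Z') {N : ℕ} (z : Fin N → Z) (f : Z → Z') {i j : Fin N}
    (hij : i < j) {k : ℕ} (hk : k = i) :
    past d (fun l : Fin j => f (z (Fin.castLE j.isLt.le l))) k = f (z i) := by
  subst hk
  rw [past, dif_pos (Fin.lt_def.1 hij)]
  rfl

/-- The codeword sent in block `b`, for a message that consists of `B` submessages. -/
def codeword {G : Type} [Zero G] {m n B : ℕ} (c : Fin m → Fin n → G) (w : Fin (m ^ B)) (b : ℕ) :
    Fin n → G :=
  -- In the last block, which carries no submessage, the zero word is sent.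
  if h : b < B then c (finFunctionFinEquiv.symm w ⟨b, h⟩) else 0

theorem codeword_val {G : Type} [Zero G] {m n B : ℕ} (c : Fin m → Fin n → G) (w : Fin (m ^ B))
    (b : Fin B) : codeword c w b = c (finFunctionFinEquiv.symm w b) := by
  simp [codeword]

/-- The ternary sequences with entries in `{0, 1}`. -/
def ternaryNoise (n : ℕ) : Finset (Fin n → ZMod 3) :=
  (Finset.univ : Finset (Fin n → Bool)).image fun s t => toTernary (s t)

theorem card_ternaryNoise_le (n : ℕ) : (ternaryNoise n).card ≤ 2 ^ n :=
  Finset.card_image_le.trans (by simp)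

/-- The decoders choose arbitrarily among the messages that pass their tests, which is right once
the true message is the only one. -/
theorem epsilon_eq {α : Type} [Nonempty α] {P : α → Prop} {w : α} (h : P w)
    (h' : ¬ ∃ w', w' ≠ w ∧ P w') : Classical.epsilon P = w := by
  by_contra hne
  exact h' ⟨_, hne, Classical.epsilon_spec ⟨w, h⟩⟩

variable {B n m₁ m₂ m₃ : ℕ}

/-- The block Markov code. In each block the three transmitters send codewords of their current
submessages; one block later transmitter 1 forwards the noise bits `E` uncoded, and transmitter 3
sends the description `F` of the noise sequence `E ⊕ N_δ`. -/
noncomputable def blockCode [NeZero m₁] [NeZero m₂] [NeZero m₃] (c₁ : Fin m₁ → Fin n → ZMod 3)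
    (c₂ : Fin m₂ → Fin n → Bool) (F : (Fin n → Bool) → Fin n → Bool) (c₃ : Fin m₃ → Fin n → Bool)
    (T T₃ Tδ : Finset (Fin n → Bool)) :
    ChannelCode (m₁ ^ B) (m₂ ^ B) (m₃ ^ B) ((B + 1) * n) where
  -- In block 0 the truncated subtraction and the default of `past` make the forwarded symbols
  -- meaningless; receiver 2 reads them only in later blocks.
  enc₁ i w z := (codeword c₁ w i.divNat i.modNat,
    decide (past 0 z (i.modNat + n * (i.divNat - 1 : ℕ)) -
      codeword c₁ w (i.divNat - 1 : ℕ) i.modNat = 1))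
  enc₂ i w _ := codeword c₂ w i.divNat i.modNat
  enc₃ i w z := (F (fun t =>
      (past 0 z (t + n * (i.divNat - 1 : ℕ))).1 - codeword c₃ w (i.divNat - 1 : ℕ) t +
        (past 0 z (t + n * (i.divNat - 1 : ℕ))).2) i.modNat,
    codeword c₃ w i.divNat i.modNat, false)
  dec₁ y := finFunctionFinEquiv fun b => Classical.epsilon fun w' =>
    (fun t => y (slot b.castSucc t)) - c₁ w' ∈ ternaryNoise n
  dec₂ y := finFunctionFinEquiv fun b => Classical.epsilon fun w' =>
    (fun t => (y (slot b.castSucc t)).1 + (y (slot b.succ t)).2.1) - c₂ w' ∈ T ∧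
      (fun t => (y (slot b.succ t)).2.2) - F ((fun t => (y (slot b.castSucc t)).1) - c₂ w') ∈ T₃
  dec₃ y := finFunctionFinEquiv fun b => Classical.epsilon fun w' =>
    (fun t => (y (slot b.castSucc t)).1) - c₃ w' ∈ Tδ

/-- The noise of receiver 1 in block `b`. -/
def noiseOne (v : Fin ((B + 1) * n) → Noise) (b : Fin B) : Fin n → ZMod 3 :=
  fun t => toTernary (v (slot b.castSucc t)).2.2.2

/-- The noise `E ⊕ N_δ` of the signal of transmitter 2 in block `b`. -/
def noiseTwo (v : Fin ((B + 1) * n) → Noise) (b : Fin B) : Fin n → Bool :=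
  fun t => (v (slot b.castSucc t)).2.2.2 + (v (slot b.castSucc t)).2.2.1

/-- The noise `N_δ ⊕ N₁` that is left at receiver 2 after the forwarded bits are subtracted. -/
def noiseLeft (v : Fin ((B + 1) * n) → Noise) (b : Fin B) : Fin n → Bool :=
  fun t => (v (slot b.castSucc t)).2.2.1 + (v (slot b.succ t)).1

/-- The noise in the description of the noise sequence of block `b`. -/
def noiseDescription (v : Fin ((B + 1) * n) → Noise) (b : Fin B) : Fin n → Bool :=
  fun t => (v (slot b.succ t)).2.1

/-- The noise of receiver 3 in block `b`. -/
def noiseThree (v : Fin ((B + 1) * n) → Noise) (b : Fin B) : Fin n → Bool :=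
  fun t => (v (slot b.castSucc t)).2.2.1

/-- Another codeword explains an output of the codeword of `w` with noise `s`. -/
def Ambiguous {G : Type} [AddGroup G] {m : ℕ} (c : Fin m → G) (T : Finset G) (w : Fin m) (s : G) :
    Prop :=
  ∃ w', w' ≠ w ∧ c w + s - c w' ∈ T

/-- Another codeword passes both tests of receiver 2. -/
def AmbiguousTwo {G : Type} [AddGroup G] {m : ℕ} (c : (Fin m → G) × (G → G)) (T T₃ : Finset G)
    (w : Fin m) (s u k : G) : Prop :=
  ∃ w', w' ≠ w ∧ c.1 w + u - c.1 w' ∈ T ∧ c.2 s + k - c.2 (c.1 w + s - c.1 w') ∈ T₃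

section Decoding

variable [NeZero m₁] [NeZero m₂] [NeZero m₃] {c₁ : Fin m₁ → Fin n → ZMod 3}
    {c₂ : Fin m₂ → Fin n → Bool} {F : (Fin n → Bool) → Fin n → Bool} {c₃ : Fin m₃ → Fin n → Bool}
    {T T₃ Tδ : Finset (Fin n → Bool)} {w : Fin (m₁ ^ B) × Fin (m₂ ^ B) × Fin (m₃ ^ B)}
    {v : Fin ((B + 1) * n) → Noise}
    {y : Fin ((B + 1) * n) → ZMod 3 × (Bool × Bool × Bool) × (Bool × Bool)}
    {z : Fin ((B + 1) * n) → ZMod 3 × Unit × (Bool × Bool)}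

theorem feedback_one (h : Consistent (blockCode c₁ c₂ F c₃ T T₃ Tδ) w v y z) (i) :
    (z i).1 = codeword c₁ w.1 i.divNat i.modNat + toTernary (v i).2.2.2 ∧ (z i).1 = (y i).1 := by
  have h1 := (h i).1
  have h2 := (h i).2
  rw [← h2, ← h1]
  simp [feedback, output, FeedbackBlockCode.input, blockCode, toTernary]

theorem feedback_three (h : Consistent (blockCode c₁ c₂ F c₃ T T₃ Tδ) w v y z) (i) :
    (z i).2.2.1 = codeword c₃ w.2.2 i.divNat i.modNat + (v i).2.2.1 ∧
      (z i).2.2.2 = (v i).2.2.2 ∧ (z i).2.2 = (y i).2.2 := by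
  have h1 := (h i).1
  have h2 := (h i).2
  rw [← h2, ← h1]
  refine ⟨rfl, ?_, rfl⟩
  simp [feedback, output, FeedbackBlockCode.input, blockCode]

theorem output_one (h : Consistent (blockCode c₁ c₂ F c₃ T T₃ Tδ) w v y z) (b : Fin B) :
    (fun t => (y (slot b.castSucc t)).1) =
      c₁ (finFunctionFinEquiv.symm w.1 b) + noiseOne v b := by
  funext t
  rw [← (feedback_one h _).2, (feedback_one h _).1, divNat_slot, modNat_slot, Fin.val_castSucc,
    codeword_val]
  rfl

theorem output_three (h : Consistent (blockCode c₁ c₂ F c₃ T T₃ Tδ) w v y z) (b : Fin B) :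
    (fun t => (y (slot b.castSucc t)).2.2.1) =
      c₃ (finFunctionFinEquiv.symm w.2.2 b) + noiseThree v b := by
  funext t
  rw [← (feedback_three h _).2.2, (feedback_three h _).1, divNat_slot, modNat_slot,
    Fin.val_castSucc, codeword_val]
  rfl

theorem output_two (h : Consistent (blockCode c₁ c₂ F c₃ T T₃ Tδ) w v y z) (b : Fin B) :
    (fun t => (y (slot b.castSucc t)).2.1.1) =
      c₂ (finFunctionFinEquiv.symm w.2.1 b) + noiseTwo v b := by
  funext t
  have h1 := congrArg (fun x => x.2.1.1) (h (slot b.castSucc t)).1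
  rw [← h1]
  change codeword c₂ w.2.1 _ _ + _ = _
  rw [divNat_slot, modNat_slot, Fin.val_castSucc, codeword_val]
  rfl

/-- Subtracting its own symbol from the noiseless feedback leaves transmitter 1 with the residue of
E, which is 1 exactly when E is. -/
theorem output_forwarded (h : Consistent (blockCode c₁ c₂ F c₃ T T₃ Tδ) w v y z) (b : Fin B)
    (t : Fin n) : (y (slot b.succ t)).2.1.2.1 =
      (v (slot b.castSucc t)).2.2.2 + (v (slot b.succ t)).1 := by
  have h1 := congrArg (fun x => x.2.1.2.1) (h (slot b.succ t)).1
  rw [← h1]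
  change decide (past 0 (fun l => (z _).1) _ - _ = 1) + _ = _
  rw [past_eq 0 z (fun x => x.1) (slot_castSucc_lt b t t)
    (by rw [divNat_slot, modNat_slot]; simp [val_slot]), (feedback_one h _).1]
  simp only [divNat_slot, modNat_slot, Fin.val_succ, Fin.val_castSucc, add_tsub_cancel_right,
    add_sub_cancel_left]
  cases (v (slot b.castSucc t)).2.2.2
  · simp [toTernary]
  · simp [toTernary]

/-- Transmitter 3 finds N_δ by subtracting its own codeword, and reads E directly because its third
input is constantly zero. -/
theorem output_description (h : Consistent (blockCode c₁ c₂ F c₃ T T₃ Tδ) w v y z) (b : Fin B) :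
    (fun t => (y (slot b.succ t)).2.1.2.2) = F (noiseTwo v b) + noiseDescription v b := by
  funext t
  have h1 := congrArg (fun x => x.2.1.2.2) (h (slot b.succ t)).1
  rw [← h1]
  change F (fun t' => (past 0 (fun l => (z _).2.2) _).1 - _ + (past 0 (fun l => (z _).2.2) _).2) _
    + _ = _
  have hF : ∀ t' : Fin n, past 0 (fun l : Fin (slot b.succ t) =>
      (z (Fin.castLE (slot b.succ t).isLt.le l)).2.2)
        (t' + n * ((slot b.succ t).divNat - 1 : ℕ)) = (z (slot b.castSucc t')).2.2 := fun t' =>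
    past_eq 0 z (fun x => x.2.2) (slot_castSucc_lt b t' t)
      (by rw [divNat_slot]; simp [val_slot])
  simp only [hF]
  have hs : (fun t' => (z (slot b.castSucc t')).2.2.1 - codeword c₃ w.2.2
      ((slot b.succ t).divNat - 1 : ℕ) t' + (z (slot b.castSucc t')).2.2.2) = noiseTwo v b := by
    funext t'
    rw [(feedback_three h _).1, (feedback_three h _).2.1]
    simp only [divNat_slot, modNat_slot, Fin.val_succ, Fin.val_castSucc, add_tsub_cancel_right,
      add_sub_cancel_left]
    exact add_comm _ _
  rw [hs, modNat_slot]
  rfl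

theorem output_two_add_forwarded (h : Consistent (blockCode c₁ c₂ F c₃ T T₃ Tδ) w v y z)
    (b : Fin B) : (fun t => (y (slot b.castSucc t)).2.1.1 + (y (slot b.succ t)).2.1.2.1) =
      c₂ (finFunctionFinEquiv.symm w.2.1 b) + noiseLeft v b := by
  funext t
  rw [output_forwarded h, congrFun (output_two h b) t, Pi.add_apply, Pi.add_apply, add_assoc]
  congr 1
  rw [noiseTwo, noiseLeft]
  generalize (v (slot b.castSucc t)).2.2.2 = e
  generalize (v (slot b.castSucc t)).2.2.1 = d
  generalize (v (slot b.succ t)).1 = a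
  revert e d a
  decide

/-- Noise outside its test set matters for only three of the tests: the noise of receiver 1 always
lies in `ternaryNoise`, and E ⊕ N_δ enters only through `F`, so it need not be typical. -/
theorem exists_of_decode_ne (h : Consistent (blockCode c₁ c₂ F c₃ T T₃ Tδ) w v y z)
    (hd : (blockCode c₁ c₂ F c₃ T T₃ Tδ).decode y ≠ w) :
    ∃ b, Ambiguous c₁ (ternaryNoise n) (finFunctionFinEquiv.symm w.1 b) (noiseOne v b) ∨
      AmbiguousTwo (c₂, F) T T₃ (finFunctionFinEquiv.symm w.2.1 b)
        (noiseTwo v b) (noiseLeft v b) (noiseDescription v b) ∨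
      Ambiguous c₃ Tδ (finFunctionFinEquiv.symm w.2.2 b) (noiseThree v b) ∨
      noiseLeft v b ∉ T ∨ noiseDescription v b ∉ T₃ ∨ noiseThree v b ∉ Tδ := by
  by_contra hcon
  push Not at hcon
  apply hd
  refine Prod.ext ?_ (Prod.ext ?_ ?_)
  · refine (Equiv.eq_symm_apply _).1 (funext fun b => epsilon_eq ?_ ?_)
    · rw [output_one h, add_sub_cancel_left]
      exact Finset.mem_image.2 ⟨_, Finset.mem_univ _, rfl⟩
    · rw [output_one h]
      exact (hcon b).1
  · refine (Equiv.eq_symm_apply _).1 (funext fun b => epsilon_eq ?_ ?_)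
    · rw [output_two h, output_two_add_forwarded h, output_description h, add_sub_cancel_left,
        add_sub_cancel_left, add_sub_cancel_left]
      exact ⟨(hcon b).2.2.2.1, (hcon b).2.2.2.2.1⟩
    · rw [output_two h, output_two_add_forwarded h, output_description h]
      exact (hcon b).2.1
  · refine (Equiv.eq_symm_apply _).1 (funext fun b => epsilon_eq ?_ ?_)
    · rw [output_three h, add_sub_cancel_left]
      exact (hcon b).2.2.2.2.2
    · rw [output_three h]
      exact (hcon b).2.2.1

end Decoding

end SecondExample

/-! ### Error analysis and existence of a good code -/

namespace SecondExample

variable {B n m₁ m₂ m₃ : ℕ}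

theorem sum_noiseLaw_mul_sign (p₁ p₃ δ : ℝ) :
    ∑ a : Noise, noiseLaw p₁ p₃ δ a * sign a.1 = 1 - 2 * p₁ ∧
      ∑ a : Noise, noiseLaw p₁ p₃ δ a * sign a.2.1 = 1 - 2 * p₃ ∧
        ∑ a : Noise, noiseLaw p₁ p₃ δ a * sign a.2.2.1 = 1 - 2 * δ := by
  simp only [Fintype.sum_prod_type, Fintype.sum_bool, noiseLaw, bern, sign]
  simp
  refine ⟨?_, ?_, ?_⟩ <;> ring

theorem sign_sq (b : Bool) : sign b ^ 2 = 1 := by cases b <;> simp [sign]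

theorem sign_add (a b : Bool) : sign (a + b) = sign a * sign b := by
  change sign (xor a b) = _
  cases a <;> cases b <;> simp [sign]

theorem sum_noiseThree_le (p₁ p₃ δ : unitInterval) (b : Fin B) {r : ℝ} (hr : (δ : ℝ) < r)
    (hn : 0 < n) :
    ∑ v : Fin ((B + 1) * n) → Noise, (∏ i, noiseLaw p₁ p₃ δ (v i)) *
      (if noiseThree v b ∉ lowWeight n r then 1 else 0) ≤ 1 / (4 * (r - δ) ^ 2) / n := by
  refine sum_ite_not_mem_lowWeight_le _ (noiseLaw_nonneg p₁ p₃ δ) (sum_noiseLaw _ _ _)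
    (fun _ a => sign a.2.2.1) (fun _ _ => sign_sq _) (fun t => {slot b.castSucc t}) ?_ δ r hr ?_
    (fun v => noiseThree v b) ?_ hn
  · intro t t' htt'
    simpa [slot_inj] using htt'
  · intro t
    rw [Finset.prod_singleton, (sum_noiseLaw_mul_sign _ _ _).2.2]
  · intro v t
    rw [Finset.prod_singleton, noiseThree]

theorem sum_noiseDescription_le (p₁ p₃ δ : unitInterval) (b : Fin B) {r : ℝ} (hr : (p₃ : ℝ) < r)
    (hn : 0 < n) :
    ∑ v : Fin ((B + 1) * n) → Noise, (∏ i, noiseLaw p₁ p₃ δ (v i)) *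
      (if noiseDescription v b ∉ lowWeight n r then 1 else 0) ≤ 1 / (4 * (r - p₃) ^ 2) / n := by
  refine sum_ite_not_mem_lowWeight_le _ (noiseLaw_nonneg p₁ p₃ δ) (sum_noiseLaw _ _ _)
    (fun _ a => sign a.2.1) (fun _ _ => sign_sq _) (fun t => {slot b.succ t}) ?_ p₃ r hr ?_
    (fun v => noiseDescription v b) ?_ hn
  · intro t t' htt'
    simpa [slot_inj] using htt'
  · intro t
    rw [Finset.prod_singleton, (sum_noiseLaw_mul_sign _ _ _).2.1]
  · intro v t
    rw [Finset.prod_singleton, noiseDescription]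

theorem sum_noiseLeft_le (p₁ p₃ δ : unitInterval) (b : Fin B) {r : ℝ} (hr : binConv p₁ δ < r)
    (hn : 0 < n) :
    ∑ v : Fin ((B + 1) * n) → Noise, (∏ i, noiseLaw p₁ p₃ δ (v i)) *
      (if noiseLeft v b ∉ lowWeight n r then 1 else 0) ≤
        1 / (4 * (r - binConv p₁ δ) ^ 2) / n := by
  have hne : b.castSucc ≠ b.succ := Fin.castSucc_lt_succ.ne
  refine sum_ite_not_mem_lowWeight_le _ (noiseLaw_nonneg p₁ p₃ δ) (sum_noiseLaw _ _ _)
    -- The two bits come from different blocks: N_δ from block `b` and N₁ from the next. Their mean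
    -- signs multiply, and (1 - 2p₁)(1 - 2δ) = 1 - 2(p₁*δ).
    (fun i a => if i.divNat = b.castSucc then sign a.2.2.1 else sign a.1)
    (fun i _ => by split_ifs <;> exact sign_sq _)
    (fun t => {slot b.castSucc t, slot b.succ t}) ?_ _ r hr ?_ (fun v => noiseLeft v b) ?_ hn
  · intro t t' htt'
    simp [slot_inj, htt'.symm]
  · intro t
    rw [Finset.prod_pair (by simp [slot_inj, hne]), divNat_slot, divNat_slot]
    simp only [if_true, hne.symm, if_false]
    rw [(sum_noiseLaw_mul_sign _ _ _).1, (sum_noiseLaw_mul_sign _ _ _).2.2, binConv]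
    ring
  · intro v t
    rw [Finset.prod_pair (by simp [slot_inj, hne]), divNat_slot, divNat_slot]
    simp only [if_true, hne.symm, if_false]
    rw [noiseLeft, sign_add]

/-- The joint law of the messages and the noise sequences. -/
noncomputable def jointLaw (p₁ p₃ δ : ℝ) {M₁ M₂ M₃ N : ℕ}
    (ω : (Fin M₁ × Fin M₂ × Fin M₃) × (Fin N → Noise)) : ℝ :=
  ((M₁ : ℝ) * M₂ * M₃)⁻¹ * ∏ i, noiseLaw p₁ p₃ δ (ω.2 i)

theorem jointLaw_nonneg (p₁ p₃ δ : unitInterval) {M₁ M₂ M₃ N : ℕ}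
    (ω : (Fin M₁ × Fin M₂ × Fin M₃) × (Fin N → Noise)) : 0 ≤ jointLaw p₁ p₃ δ ω :=
  mul_nonneg (by positivity) (Finset.prod_nonneg fun _ _ => noiseLaw_nonneg _ _ _ _)

theorem sum_jointLaw_mul (p₁ p₃ δ : ℝ) {M₁ M₂ M₃ N : ℕ} (h₁ : M₁ ≠ 0) (h₂ : M₂ ≠ 0) (h₃ : M₃ ≠ 0)
    (ψ : (Fin N → Noise) → ℝ) :
    ∑ ω : (Fin M₁ × Fin M₂ × Fin M₃) × (Fin N → Noise), jointLaw p₁ p₃ δ ω * ψ ω.2 =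
      ∑ v : Fin N → Noise, (∏ i, noiseLaw p₁ p₃ δ (v i)) * ψ v := by
  rw [Fintype.sum_prod_type]
  simp only [jointLaw, mul_assoc, ← Finset.mul_sum, Finset.sum_const, Finset.card_univ,
    Fintype.card_prod, Fintype.card_fin, nsmul_eq_mul]
  push_cast
  field_simp

theorem sum_jointLaw (p₁ p₃ δ : ℝ) {M₁ M₂ M₃ N : ℕ} (h₁ : M₁ ≠ 0) (h₂ : M₂ ≠ 0) (h₃ : M₃ ≠ 0) :
    ∑ ω : (Fin M₁ × Fin M₂ × Fin M₃) × (Fin N → Noise), jointLaw p₁ p₃ δ ω = 1 := by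
  have := sum_jointLaw_mul p₁ p₃ δ h₁ h₂ h₃ (N := N) (fun _ => 1)
  simp only [mul_one] at this
  rw [this]
  have := sum_prod_mul_prod (ι := Fin N) (noiseLaw p₁ p₃ δ) (sum_noiseLaw _ _ _) (fun _ _ => 1) ∅
  simpa using this

theorem sum_jointLaw_mul_sum_le (p₁ p₃ δ : ℝ) {M₁ M₂ M₃ N : ℕ} (h₁ : M₁ ≠ 0) (h₂ : M₂ ≠ 0)
    (h₃ : M₃ ≠ 0) (ψ : Fin B → (Fin N → Noise) → ℝ) {a : ℝ}
    (h : ∀ b, ∑ v : Fin N → Noise, (∏ i, noiseLaw p₁ p₃ δ (v i)) * ψ b v ≤ a) :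
    ∑ ω : (Fin M₁ × Fin M₂ × Fin M₃) × (Fin N → Noise), jointLaw p₁ p₃ δ ω * ∑ b, ψ b ω.2 ≤
      B * a := by
  rw [sum_jointLaw_mul p₁ p₃ δ h₁ h₂ h₃ (fun v => ∑ b, ψ b v)]
  simp only [Finset.mul_sum]
  rw [Finset.sum_comm]
  exact (Finset.sum_le_sum fun b _ => h b).trans (by simp)

/-- A good deterministic code obtained by random coding. -/
theorem exists_code (B n : ℕ) (hn : 0 < n) [NeZero m₁] [NeZero m₂] [NeZero m₃]
    (p₁ p₃ δ : unitInterval) (r r₃ rδ : ℝ) (hr : binConv p₁ δ < r) (hr₃ : (p₃ : ℝ) < r₃)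
    (hrδ : (δ : ℝ) < rδ) :
    ∃ c : ChannelCode (m₁ ^ B) (m₂ ^ B) (m₃ ^ B) ((B + 1) * n),
      c.errorProb (channel p₁ p₃ δ 0) ≤ B * ((m₁ - 1) * (2 ^ n / 3 ^ n) +
        (m₂ - 1) * (1 / 2 ^ n +
          (lowWeight n r).card / 2 ^ n * ((lowWeight n r₃).card / 2 ^ n)) +
        (m₃ - 1) * ((lowWeight n rδ).card / 2 ^ n) +
        (1 / (4 * (r - binConv p₁ δ) ^ 2) + 1 / (4 * (r₃ - p₃) ^ 2) + 1 / (4 * (rδ - δ) ^ 2)) /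
          n) := by
  classical
  have h₁ : m₁ ^ B ≠ 0 := pow_ne_zero _ (NeZero.ne _)
  have h₂ : m₂ ^ B ≠ 0 := pow_ne_zero _ (NeZero.ne _)
  have h₃ : m₃ ^ B ≠ 0 := pow_ne_zero _ (NeZero.ne _)
  have hm₁ : (1 : ℝ) ≤ m₁ := by exact_mod_cast NeZero.one_le
  let Ω := (Fin (m₁ ^ B) × Fin (m₂ ^ B) × Fin (m₃ ^ B)) × (Fin ((B + 1) * n) → Noise)
  let P : Ω → ℝ := jointLaw p₁ p₃ δ
  have hP0 : ∀ ω, 0 ≤ P ω := jointLaw_nonneg p₁ p₃ δ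
  have hP1 : ∑ ω, P ω = 1 := sum_jointLaw p₁ p₃ δ h₁ h₂ h₃
  -- The counts `φ₁`, `φ₂`, `φ₃` of ambiguous blocks involve separate parts of the code, so each
  -- part can be chosen on its own.
  let φ₁ : (Fin m₁ → Fin n → ZMod 3) → Ω → ℝ := fun c ω => ∑ b,
    if Ambiguous c (ternaryNoise n) (finFunctionFinEquiv.symm ω.1.1 b) (noiseOne ω.2 b)
      then 1 else 0
  let φ₂ : (Fin m₂ → Fin n → Bool) × ((Fin n → Bool) → Fin n → Bool) → Ω → ℝ := fun c ω => ∑ b,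
    if AmbiguousTwo c (lowWeight n r) (lowWeight n r₃) (finFunctionFinEquiv.symm ω.1.2.1 b)
      (noiseTwo ω.2 b) (noiseLeft ω.2 b) (noiseDescription ω.2 b) then 1 else 0
  let φ₃ : (Fin m₃ → Fin n → Bool) → Ω → ℝ := fun c ω => ∑ b,
    if Ambiguous c (lowWeight n rδ) (finFunctionFinEquiv.symm ω.1.2.2 b) (noiseThree ω.2 b)
      then 1 else 0
  obtain ⟨c₁, hc₁⟩ := exists_sum_le_of_forall_sum_le P hP0 hP1 φ₁
    (B * ((m₁ - 1) * (2 ^ n / 3 ^ n))) (fun ω => by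
      rw [Finset.sum_comm]
      refine (Finset.sum_le_sum fun b _ => ?_).trans_eq (b := ∑ _b : Fin B, (m₁ - 1) *
        (2 ^ n / 3 ^ n) * (Fintype.card (Fin m₁ → Fin n → ZMod 3) : ℝ)) ?_
      · have h := sum_ite_ambiguous_le (finFunctionFinEquiv.symm ω.1.1 b) (noiseOne ω.2 b)
          (ternaryNoise n)
        refine (le_of_eq_of_le ?_ h).trans ?_
        · exact Finset.sum_congr rfl fun c _ => if_congr Iff.rfl rfl rfl
        · have hT : ((ternaryNoise n).card : ℝ) ≤ 2 ^ n := by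
            exact_mod_cast card_ternaryNoise_le n
          have hH : (Fintype.card (Fin n → ZMod 3) : ℝ) = 3 ^ n := by simp [ZMod.card]
          rw [hH]
          refine mul_le_mul_of_nonneg_right ?_ (by positivity)
          refine mul_le_mul_of_nonneg_left ?_ (by linarith)
          gcongr
      · simp [mul_assoc])
  have hH : (Fintype.card (Fin n → Bool) : ℝ) = 2 ^ n := by simp
  obtain ⟨⟨c₂, F⟩, hc₂⟩ := exists_sum_le_of_forall_sum_le P hP0 hP1 φ₂
    (B * ((m₂ - 1) * (1 / 2 ^ n +
          (lowWeight n r).card / 2 ^ n * ((lowWeight n r₃).card / 2 ^ n)))) (fun ω => by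
      rw [Finset.sum_comm, ← hH, mul_assoc]
      refine (Finset.sum_le_sum fun b _ => ?_).trans_eq (Fin.sum_const B _ |>.trans
        (nsmul_eq_mul _ _))
      refine le_of_eq_of_le ?_ (sum_ite_ambiguous_describe_le (finFunctionFinEquiv.symm ω.1.2.1 b)
        (noiseTwo ω.2 b) (noiseLeft ω.2 b) (noiseDescription ω.2 b) (lowWeight n r)
        (lowWeight n r₃))
      exact Finset.sum_congr rfl fun c _ => if_congr Iff.rfl rfl rfl)
  obtain ⟨c₃, hc₃⟩ := exists_sum_le_of_forall_sum_le P hP0 hP1 φ₃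
    (B * ((m₃ - 1) * ((lowWeight n rδ).card / 2 ^ n))) (fun ω => by
      rw [Finset.sum_comm, ← hH, mul_assoc]
      refine (Finset.sum_le_sum fun b _ => ?_).trans_eq (Fin.sum_const B _ |>.trans
        (nsmul_eq_mul _ _))
      refine le_of_eq_of_le ?_ (sum_ite_ambiguous_le (finFunctionFinEquiv.symm ω.1.2.2 b)
        (noiseThree ω.2 b) (lowWeight n rδ))
      exact Finset.sum_congr rfl fun c _ => if_congr Iff.rfl rfl rfl)
  refine ⟨blockCode c₁ c₂ F c₃ (lowWeight n r) (lowWeight n r₃) (lowWeight n rδ), ?_⟩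
  -- The atypical-noise events do not depend on the code; Chebyshev's inequality bounds them.
  let ψ : (Fin ((B + 1) * n) → Noise) → Fin B → ℝ := fun v b =>
    (if noiseLeft v b ∉ lowWeight n r then 1 else 0) +
      (if noiseDescription v b ∉ lowWeight n r₃ then 1 else 0) +
      (if noiseThree v b ∉ lowWeight n rδ then 1 else 0)
  have hψ := sum_jointLaw_mul_sum_le p₁ p₃ δ h₁ h₂ h₃ (fun b v => ψ v b) (fun b => by
    simp only [ψ, mul_add, Finset.sum_add_distrib]
    exact add_le_add (add_le_add (sum_noiseLeft_le p₁ p₃ δ b hr hn)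
      (sum_noiseDescription_le p₁ p₃ δ b hr₃ hn)) (sum_noiseThree_le p₁ p₃ δ b hrδ hn))
  have hψ0 : ∀ v b, 0 ≤ ψ v b := fun v b => by positivity
  have hφ0 : ∀ ω, 0 ≤ φ₁ c₁ ω ∧ 0 ≤ φ₂ (c₂, F) ω ∧ 0 ≤ φ₃ c₃ ω := fun ω =>
    ⟨Finset.sum_nonneg fun _ _ => by positivity, Finset.sum_nonneg fun _ _ => by positivity,
      Finset.sum_nonneg fun _ _ => by positivity⟩
  have hs0 : ∀ v, 0 ≤ ∑ b, ψ v b := fun v => Finset.sum_nonneg fun b _ => hψ0 v b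
  refine (errorProb_le _ p₁ p₃ δ
    (fun w v => φ₁ c₁ (w, v) + φ₂ (c₂, F) (w, v) + φ₃ c₃ (w, v) + ∑ b, ψ v b)
    (fun w v => ?_) (fun w v y z hc hd => ?_)).trans ?_
  · have := hφ0 (w, v); have := hs0 v; linarith
  · have := hφ0 (w, v)
    have h0 := hs0 v
    have hone : ∀ {q : Fin B → Prop} {b : Fin B}, q b →
        (1 : ℝ) ≤ ∑ b, if q b then 1 else 0 := fun {q b} hb => by
      refine le_trans ?_ (Finset.single_le_sum (f := fun b => if q b then (1 : ℝ) else 0)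
        (fun i _ => by positivity) (Finset.mem_univ b))
      simp [hb]
    obtain ⟨b, hb⟩ := exists_of_decode_ne hc hd
    have hle := Finset.single_le_sum (f := ψ v) (fun i _ => hψ0 v i) (Finset.mem_univ b)
    have i0 : ∀ (q : Prop) [Decidable q], 0 ≤ if q then (1 : ℝ) else 0 := fun q _ => by positivity
    have h4 := i0 (noiseLeft v b ∉ lowWeight n r)
    have h5 := i0 (noiseDescription v b ∉ lowWeight n r₃)
    have h6 := i0 (noiseThree v b ∉ lowWeight n rδ)
    rcases hb with hb | hb | hb | hb | hb | hb
    · have : 1 ≤ φ₁ c₁ (w, v) := hone hb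
      linarith
    · have : 1 ≤ φ₂ (c₂, F) (w, v) := hone hb
      linarith
    · have : 1 ≤ φ₃ c₃ (w, v) := hone hb
      linarith
    all_goals
      have : 1 ≤ ψ v b := by
        simp only [ψ]
        rw [if_pos hb]
        linarith
      linarith
  · have heq : (((m₁ ^ B : ℕ) : ℝ) * (m₂ ^ B : ℕ) * (m₃ ^ B : ℕ))⁻¹ *
        ∑ w, ∑ v : Fin ((B + 1) * n) → Noise, (∏ i, noiseLaw p₁ p₃ δ (v i)) *
          (φ₁ c₁ (w, v) + φ₂ (c₂, F) (w, v) + φ₃ c₃ (w, v) + ∑ b, ψ v b) =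
        ∑ ω, P ω * φ₁ c₁ ω + ∑ ω, P ω * φ₂ (c₂, F) ω + ∑ ω, P ω * φ₃ c₃ ω +
          ∑ ω, P ω * ∑ b, ψ ω.2 b := by
      simp only [← Finset.sum_add_distrib, ← mul_add]
      rw [Finset.mul_sum]
      refine Eq.trans (Finset.sum_congr rfl fun w _ => ?_) (Fintype.sum_prod_type _).symm
      rw [Finset.mul_sum]
      refine Finset.sum_congr rfl fun v _ => ?_
      simp only [P, jointLaw, mul_assoc]
    rw [heq]
    refine (add_le_add (add_le_add (add_le_add hc₁ hc₂) hc₃) hψ).trans_eq ?_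
    ring

end SecondExample

/-! ### Entropy, rates and choice of parameters -/

theorem continuous_hb : Continuous hb := Real.binEntropy_continuous.div_const _

theorem hb_nonneg {p : ℝ} (h0 : 0 ≤ p) (h1 : p ≤ 1) : 0 ≤ hb p :=
  div_nonneg (Real.binEntropy_nonneg h0 h1) (Real.log_nonneg one_le_two)

theorem hb_le_one (p : ℝ) : hb p ≤ 1 :=
  (div_le_one (Real.log_pos one_lt_two)).2 Real.binEntropy_le_log_two

theorem hb_hbInv {x : ℝ} (h0 : 0 ≤ x) (h1 : x ≤ 1) : hb (hbInv x) = x := by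
  have h : x ∈ hb '' Set.Icc 0 (1 / 2) := by
    refine intermediate_value_Icc (by norm_num) continuous_hb.continuousOn ⟨?_, ?_⟩
    · simpa [hb] using h0
    · have : hb (1 / 2) = 1 := by
        rw [hb, one_div, Real.binEntropy_two_inv, div_self (Real.log_pos one_lt_two).ne']
      rwa [this]
  exact Function.invFunOn_eq h

/-- The threshold must exceed `q` for Chebyshev's inequality and lie strictly between 0 and 1/2 for
the counting bound, even when `q = 0`; continuity keeps the entropy cost small. -/
theorem exists_hb_lt {q ε : ℝ} (hq0 : 0 ≤ q) (hq : q < 1 / 2) (hε : 0 < ε) :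
    ∃ r, q < r ∧ 0 < r ∧ r < 1 / 2 ∧ hb r < hb q + ε := by
  have h1 : ∀ᶠ r in nhdsWithin q (Set.Ioi q), hb r < hb q + ε :=
    (continuous_hb.continuousAt.eventually (Iio_mem_nhds (by linarith))).filter_mono
      nhdsWithin_le_nhds
  have h2 : ∀ᶠ r in nhdsWithin q (Set.Ioi q), r ∈ Set.Ioo q (1 / 2) := Ioo_mem_nhdsGT hq
  obtain ⟨r, hr, hr1, hr2⟩ := (h1.and h2).exists
  exact ⟨r, hr1, by linarith, hr2, hr⟩

/-- A number of submessages of rate at least `ρ`, and not more than needed. -/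
theorem exists_messages (n : ℕ) (ρ : ℝ) :
    ∃ m : ℕ, m ≠ 0 ∧ (m : ℝ) - 1 ≤ 2 ^ (n * ρ) ∧ n * ρ ≤ Real.logb 2 m := by
  have hpos : (0 : ℝ) < 2 ^ (n * ρ) := by positivity
  have hc := Nat.ceil_pos.2 hpos
  refine ⟨⌈(2 : ℝ) ^ (n * ρ)⌉₊, hc.ne', ?_, ?_⟩
  · have := Nat.ceil_lt_add_one hpos.le
    linarith
  · rw [Real.le_logb_iff_rpow_le one_lt_two (by exact_mod_cast hc)]
    exact Nat.le_ceil _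

/-- The block without submessages costs at most 1/(B + 1) ≤ η/2 in rate, and the submessages give up
the other η/2. -/
theorem rate_le {B n m : ℕ} (hn : 0 < n) {R η : ℝ} (hη : 0 < η) (hR : R ≤ 1)
    (hB : 2 / η ≤ B + 1) (hm : n * (R - η / 2) ≤ Real.logb 2 m) :
    R - η ≤ 1 / (((B + 1) * n : ℕ) : ℝ) * Real.logb 2 ((m ^ B : ℕ) : ℝ) := by
  have hn' : (0 : ℝ) < n := by exact_mod_cast hn
  have hB' : (0 : ℝ) ≤ B := B.cast_nonneg
  rw [Nat.cast_pow, Real.logb_pow, one_div_mul_eq_div, le_div_iff₀ (by positivity)]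
  rw [div_le_iff₀ hη] at hB
  push_cast
  have h1 : (B : ℝ) * (n * (R - η / 2)) ≤ B * Real.logb 2 m := mul_le_mul_of_nonneg_left hm hB'
  have h2 : (R - η) * (B + 1) ≤ B * (R - η / 2) := by nlinarith
  nlinarith

theorem lemma3 (p₁ p₃ δ : unitInterval)
    (hp₁ : (p₁ : ℝ) < 1 / 2) (hp₃ : (p₃ : ℝ) < 1 / 2) (hδ : (δ : ℝ) < 1 / 2) :
    (SecondExample.channel p₁ p₃ δ 0).Achievable
      (Real.logb 2 3 - 1)
      (1 - hb (hbInv (max (hb (binConv p₁ δ) + hb p₃ - 1) 0)))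
      (1 - hb δ) := by
  intro η hη
  have hp₁0 := p₁.2.1
  have hδ0 := δ.2.1
  have hq0 : 0 ≤ binConv p₁ δ := by unfold binConv; nlinarith
  have hq : binConv p₁ δ < 1 / 2 := by unfold binConv; nlinarith
  rw [hb_hbInv (le_max_right _ _) (max_le (by linarith [hb_le_one (binConv p₁ δ), hb_le_one p₃])
    zero_le_one)]
  set R₁ := Real.logb 2 3 - 1 with hR₁
  set R₂ := 1 - max (hb (binConv p₁ δ) + hb p₃ - 1) 0 with hR₂
  set R₃ := 1 - hb δ with hR₃
  have hR₁1 : R₁ ≤ 1 := by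
    have : Real.logb 2 3 ≤ 2 := by
      rw [Real.logb_le_iff_le_rpow one_lt_two (by norm_num)]; norm_num
    linarith
  -- The two bounds on `R₂` match the two ways to be ambiguous at receiver 2: colliding codewords,
  -- and passing both tests.
  have hR₂1 : R₂ ≤ 1 := by linarith [le_max_right (hb (binConv p₁ δ) + hb p₃ - 1) 0]
  have hR₂2 : R₂ ≤ 2 - hb (binConv p₁ δ) - hb p₃ := by
    linarith [le_max_left (hb (binConv p₁ δ) + hb p₃ - 1) 0]
  have hR₃1 : R₃ ≤ 1 := by linarith [hb_nonneg hδ0 δ.2.2]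
  -- Of the rate slack η/2, the entropy thresholds of each receiver use at most η/4 in total; the
  -- remaining η/4 is the error exponent.
  obtain ⟨r, hr, hr0, hr1, hrh⟩ := exists_hb_lt hq0 hq (show 0 < η / 8 by positivity)
  obtain ⟨r₃, hr₃, hr₃0, hr₃1, hr₃h⟩ := exists_hb_lt p₃.2.1 hp₃ (show 0 < η / 8 by positivity)
  obtain ⟨rδ, hrδ, hrδ0, hrδ1, hrδh⟩ := exists_hb_lt hδ0 hδ (show 0 < η / 4 by positivity)
  obtain ⟨B, hB⟩ := exists_nat_ge (2 / η)
  have hB' : 2 / η ≤ (B : ℝ) + 1 := by linarith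
  set C := 1 / (4 * (r - binConv p₁ δ) ^ 2) + 1 / (4 * (r₃ - p₃) ^ 2) + 1 / (4 * (rδ - δ) ^ 2)
    with hC
  -- `B` is fixed before `n` grows. The 4 counts the exponential terms: one each for receivers 1 and
  -- 3, two for receiver 2.
  have hlim : Filter.Tendsto (fun n : ℕ => B * (4 * ((2 : ℝ) ^ (-(η / 4))) ^ n + C / n))
      Filter.atTop (nhds 0) := by
    have h1 : Filter.Tendsto (fun n : ℕ => ((2 : ℝ) ^ (-(η / 4))) ^ n) Filter.atTop (nhds 0) :=
      tendsto_pow_atTop_nhds_zero_of_lt_one (by positivity)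
        (Real.rpow_lt_one_of_one_lt_of_neg one_lt_two (by linarith))
    have h2 : Filter.Tendsto (fun n : ℕ => C / (n : ℝ)) Filter.atTop (nhds 0) :=
      tendsto_const_div_atTop_nhds_zero_nat C
    simpa using ((h1.const_mul 4).add h2).const_mul (B : ℝ)
  obtain ⟨n, hnη, hn⟩ := ((hlim.eventually (Iio_mem_nhds hη)).and
    (Filter.eventually_gt_atTop 0)).exists
  have hn' : (0 : ℝ) ≤ n := n.cast_nonneg
  obtain ⟨m₁, hm₁, hm₁u, hm₁l⟩ := exists_messages n (R₁ - η / 2)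
  obtain ⟨m₂, hm₂, hm₂u, hm₂l⟩ := exists_messages n (R₂ - η / 2)
  obtain ⟨m₃, hm₃, hm₃u, hm₃l⟩ := exists_messages n (R₃ - η / 2)
  have : NeZero m₁ := ⟨hm₁⟩
  have : NeZero m₂ := ⟨hm₂⟩
  have : NeZero m₃ := ⟨hm₃⟩
  obtain ⟨c, hc⟩ := SecondExample.exists_code (m₁ := m₁) (m₂ := m₂) (m₃ := m₃) B n hn p₁ p₃ δ
    r r₃ rδ hr hr₃ hrδ
  refine ⟨m₁ ^ B, m₂ ^ B, m₃ ^ B, (B + 1) * n, by positivity, by positivity, by positivity,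
    by positivity, c, ?_, rate_le hn hη hR₁1 hB' hm₁l, rate_le hn hη hR₂1 hB' hm₂l,
    rate_le hn hη hR₃1 hB' hm₃l⟩
  refine hc.trans (le_trans ?_ (le_of_lt hnη))
  have hx : ((2 : ℝ) ^ (-(η / 4))) ^ n = 2 ^ (n * -(η / 4)) := by
    rw [← Real.rpow_natCast, ← Real.rpow_mul two_pos.le, mul_comm]
  have h2n : (2 : ℝ) ^ n = 2 ^ (n * (1 : ℝ)) := by rw [mul_one, Real.rpow_natCast]
  have h3n : (3 : ℝ) ^ n = 2 ^ (n * Real.logb 2 3) := by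
    rw [mul_comm, Real.rpow_mul two_pos.le, Real.rpow_logb two_pos (by norm_num) (by norm_num),
      Real.rpow_natCast]
  have hmono : ∀ {a b : ℝ}, a ≤ b → (2 : ℝ) ^ (n * a) ≤ 2 ^ (n * b) := fun h =>
    Real.rpow_le_rpow_of_exponent_le one_le_two (mul_le_mul_of_nonneg_left h hn')
  have hmul : ∀ a b : ℝ, (2 : ℝ) ^ (n * a) * 2 ^ (n * b) = 2 ^ (n * (a + b)) := fun a b => by
    rw [← Real.rpow_add two_pos, mul_add]
  have hdiv : ∀ a b : ℝ, (2 : ℝ) ^ (n * a) / 2 ^ (n * b) = 2 ^ (n * (a - b)) := fun a b => by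
    rw [← Real.rpow_sub two_pos, mul_sub]
  have hone : (1 : ℝ) = 2 ^ (n * (0 : ℝ)) := by simp
  rw [hx]
  have e₁ : ((m₁ : ℝ) - 1) * (2 ^ n / 3 ^ n) ≤ 2 ^ (n * -(η / 4)) := by
    refine (mul_le_mul_of_nonneg_right hm₁u (by positivity)).trans ?_
    rw [h2n, h3n, hdiv, hmul]
    exact hmono (by linarith)
  have e₂ : ((m₂ : ℝ) - 1) * (1 / 2 ^ n +
      (lowWeight n r).card / 2 ^ n * ((lowWeight n r₃).card / 2 ^ n)) ≤
        2 * 2 ^ (n * -(η / 4)) := by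
    have hT : ((lowWeight n r).card : ℝ) / 2 ^ n ≤ 2 ^ (n * (hb r - 1)) := by
      rw [← hdiv, ← h2n]
      gcongr
      exact card_lowWeight_le n hr0 hr1
    have hT₃ : ((lowWeight n r₃).card : ℝ) / 2 ^ n ≤ 2 ^ (n * (hb r₃ - 1)) := by
      rw [← hdiv, ← h2n]
      gcongr
      exact card_lowWeight_le n hr₃0 hr₃1
    have h1 : (1 : ℝ) / 2 ^ n = 2 ^ (n * (0 - 1 : ℝ)) := by rw [← hdiv, ← h2n, ← hone]
    refine (mul_le_mul hm₂u (add_le_add h1.le (mul_le_mul hT hT₃ (by positivity)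
      (by positivity))) (by positivity) (by positivity)).trans ?_
    rw [hmul, mul_add, hmul, hmul, two_mul]
    exact add_le_add (hmono (by linarith)) (hmono (by linarith))
  have e₃ : ((m₃ : ℝ) - 1) * ((lowWeight n rδ).card / 2 ^ n) ≤ 2 ^ (n * -(η / 4)) := by
    have hT : ((lowWeight n rδ).card : ℝ) / 2 ^ n ≤ 2 ^ (n * (hb rδ - 1)) := by
      rw [← hdiv, ← h2n]
      gcongr
      exact card_lowWeight_le n hrδ0 hrδ1
    refine (mul_le_mul hm₃u hT (by positivity) (by positivity)).trans ?_
    rw [hmul]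
    exact hmono (by linarith)
  refine mul_le_mul_of_nonneg_left ?_ B.cast_nonneg
  linarith
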